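/- Let $M$ be a smooth manifold and $E\to M$ a smooth real vector bundle of finite rank. For $x\in M$ let $(\mathfrak JE)_x$ be the space of first jets $[u]_x$ at $x$ of sections $u\in\Gamma(E)$, and let $(\mathfrak DE)_x$ be the space of pairs $\delta=(\delta,X)$ of a linear map $\delta:\Gamma(E)\to E_x$ and a tangent vector $X\in T_xM$ (the symbol of $\delta$) such that $\delta(fu)=f(x)\delta(u)+X(f)u(x)$ for all $f\in C^\infty(M)$, $u\in\Gamma(E)$. These are the fibres of the first jet bundle $\mathfrak JE$ and of the gauge Lie algebroid $\mathfrak DE$. Sections of $\mathfrak DE$ act on $\Gamma(E)$, and $\Gamma(\mathfrak DE)$ carries the commutator bracket $[\cdot,\cdot]_{\mathfrak D}$. For $u\in\Gamma(E)$ let $\mathbb d u\in\Gamma(\mathfrak JE)$ be the section $x\mapsto[u]_x$. There is an $E$-valued pairing $\langle[u]_x,\delta\rangle_E=\delta(u)$, and for $\mathfrak d\in\Gamma(\mathfrak DE)$ the Lie derivative $\mathfrak L_{\mathfrak d}$ on $\Gamma(\mathfrak JE)$ is determined by $\langle\mathfrak L_{\mathfrak d}\mu,\mathfrak t\rangle_E=\mathfrak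 d\langle\mu,\mathfrak t\rangle_E-\langle\mu,[\mathfrak d,\mathfrak t]_{\mathfrak D}\rangle_E$ for all $\mathfrak t\in\Gamma(\mathfrak DE)$. The omni-Lie algebroid of $E$ is $\mathfrak DE\oplus\mathfrak JE$ with the pairing $(\mathfrak d+\mu,\mathfrak t+\nu)_E=\tfrac12(\langle\mu,\mathfrak t\rangle_E+\langle\nu,\mathfrak d\rangle_E)$ and, on sections, the bracket $$[\![\mathfrak d+\mu,\mathfrak r+\nu]\!]=[\mathfrak d,\mathfrak r]_{\mathfrak D}+\mathfrak L_{\mathfrak d}\nu-\mathfrak L_{\mathfrak r}\mu+\mathbb d\langle\mu,\mathfrak r\rangle_E .$$ A generalized complex structure on it is a vector bundle endomorphism $\mathcal J$ of $\mathfrak DE\oplus\mathfrak JE$ (over $\mathrm{id}_M$) such that $\mathcal J^2=-\mathrm{id}$, $(\mathcal Je,\mathcal Je')_E=(e,e')_E$ for all $e,e'$ in the same fibre, and $[\![\mathcal Js,\mathcal Jt]\!]-[\![s,t]\!]-\mathcal J\big([\![\mathcal Js,t]\!]+[\![s,\mathcal Jt]\!]\big)=0$ for all sections $s,t\in\Gamma(\mathfrak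 DE\oplus\mathfrak JE)$. Let $(E,[\cdot,\cdot]_E,a)$ be a Lie algebroid over $M$, and let $\pi^\sharp:\mathfrak JE\to\mathfrak DE$ be the induced vector bundle map, determined by $\pi^\sharp(\mathbb d u)=[u,\cdot]_E$ (with symbol $a(u)$) for $u\in\Gamma(E)$. If $\pi^\sharp$ is an isomorphism of vector bundles, then $$\mathcal J=\begin{pmatrix}0&\pi^\sharp\\-(\pi^\sharp)^{-1}&0\end{pmatrix},\qquad \mathcal J(\mathfrak d+\mu)=\pi^\sharp(\mu)-(\pi^\sharp)^{-1}(\mathfrak d),$$ is a generalized complex structure on the omni-Lie algebroid $\mathfrak DE\oplus\mathfrak JE$. -/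

import Mathlib

open Bundle Filter
open scoped Manifold ContDiff Topology

set_option linter.unusedSectionVars false

noncomputable section

namespace OmniLie

variable (V : Type*) [NormedAddCommGroup V] [NormedSpace ℝ V] [FiniteDimensional ℝ V]
  {M : Type*} [TopologicalSpace M] [T2Space M] [ChartedSpace V M] [IsManifold 𝓘(ℝ, V) ∞ M]
  (F : Type*) [NormedAddCommGroup F] [NormedSpace ℝ F] [FiniteDimensional ℝ F]
  (E : M → Type*) [TopologicalSpace (TotalSpace F E)]
  [∀ x, AddCommGroup (E x)] [∀ x, Module ℝ (E x)] [∀ x, TopologicalSpace (E x)]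
  [FiberBundle F E] [VectorBundle ℝ F E] [ContMDiffVectorBundle ∞ F E 𝓘(ℝ, V)]

/-- Smooth real functions on `M`. -/
abbrev Fn (M : Type*) [TopologicalSpace M] [ChartedSpace V M] := C^∞⟮𝓘(ℝ, V), M; ℝ⟯

/-- Smooth sections of the vector bundle `E → M`. -/
abbrev Sec := Cₛ^∞⟮𝓘(ℝ, V); F, E⟯

variable {V F E}

lemma Fn.add_apply (f g : Fn V M) (x : M) : (f + g) x = f x + g x := rfl

lemma Fn.mul_apply (f g : Fn V M) (x : M) : (f * g) x = f x * g x := rfl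

lemma Fn.smul_apply (r : ℝ) (f : Fn V M) (x : M) : (r • f) x = r * f x := rfl

/-- The product of a smooth function and a smooth section. -/
def fmul (f : Fn V M) (u : Sec V F E) : Sec V F E :=
  ⟨fun x => f x • u x, f.contMDiff.smul_section u.contMDiff⟩

@[simp] lemma fmul_apply (f : Fn V M) (u : Sec V F E) (x : M) : fmul f u x = f x • u x := rfl

/-- Smoothness of a vector field. -/
def SmoothField (X : ∀ x : M, TangentSpace 𝓘(ℝ, V) x) : Prop :=
  ContMDiff 𝓘(ℝ, V) 𝓘(ℝ, V).tangent ∞ (fun x => (TotalSpace.mk x (X x) : TangentBundle 𝓘(ℝ, V) M))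

/-- The derivative `X(f)` of a smooth function along a smooth vector field. -/
lemma contMDiff_dir {f : M → ℝ} (hf : ContMDiff 𝓘(ℝ, V) 𝓘(ℝ, ℝ) ∞ f)
    {X : ∀ x : M, TangentSpace 𝓘(ℝ, V) x} (hX : SmoothField X) :
    ContMDiff 𝓘(ℝ, V) 𝓘(ℝ, ℝ) ∞ (fun x => mvfderiv 𝓘(ℝ, V) f x (X x)) := by
  have h1 := (hf.contMDiff_tangentMap (m := ∞) (by simp)).comp hX
  exact (contMDiff_snd_tangentBundle_modelSpace ℝ 𝓘(ℝ, ℝ)).comp h1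

lemma exists_sec (x : M) (v : E x) :
    ∃ u : Sec V F E, u x = v := by
  obtain ⟨s, hs, h⟩ := FiberBundle.exists_contMDiffOn_extend (k := ∞) 𝓘(ℝ, V) F v
  obtain ⟨U, hU, hUo, hxU⟩ := mem_nhds_iff.1 hs
  obtain ⟨χ, -, hχ⟩ := ((SmoothBumpFunction.nhds_basis_tsupport (I := 𝓘(ℝ, V)) x).mem_iff.1
    (hUo.mem_nhds hxU))
  exact ⟨⟨_, ContMDiffOn.smul_section_of_tsupport (ψ := χ) χ.contMDiff.contMDiffOn hUo hχ
    (h.mono hU)⟩, by simp⟩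

lemma SmoothField.lieBracket {X Y : ∀ x : M, TangentSpace 𝓘(ℝ, V) x}
    (hX : SmoothField X) (hY : SmoothField Y) :
    SmoothField (VectorField.mlieBracket 𝓘(ℝ, V) X Y) := by
  have h2 : (2 : WithTop ℕ∞) ≤ ∞ := WithTop.coe_le_coe.2 (le_top : (2 : ℕ∞) ≤ ⊤)
  have : IsManifold 𝓘(ℝ, V) (minSmoothness ℝ 2) M :=
    .of_le (n := ∞) (by simpa [minSmoothness_of_isRCLikeNormedField] using h2)
  have : IsManifold 𝓘(ℝ, V) ((⊤ : ℕ∞) + 1) M := .of_le (n := ∞) (by simp)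
  exact ContDiff.mlieBracket_vectorField (n := ⊤) (m := ⊤) hX hY
    (by simp [minSmoothness_of_isRCLikeNormedField])

lemma dir_lieBracket {f : M → ℝ} (hf : ContMDiff 𝓘(ℝ, V) 𝓘(ℝ, ℝ) ∞ f)
    {X Y : ∀ x : M, TangentSpace 𝓘(ℝ, V) x} (hX : SmoothField X) (hY : SmoothField Y) (x : M) :
    mvfderiv 𝓘(ℝ, V) f x (VectorField.mlieBracket 𝓘(ℝ, V) X Y x) =
      mvfderiv 𝓘(ℝ, V) (fun y => mvfderiv 𝓘(ℝ, V) f y (Y y)) x (X x)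
      - mvfderiv 𝓘(ℝ, V) (fun y => mvfderiv 𝓘(ℝ, V) f y (X y)) x (Y x) := by
  rcases subsingleton_or_nontrivial V with hV | hV
  · have (Z : TangentSpace 𝓘(ℝ, V) x) : Z = 0 := Subsingleton.elim (α := V) _ _
    rw [this (VectorField.mlieBracket 𝓘(ℝ, V) X Y x), this (X x), this (Y x)]; simp
  obtain ⟨w, hw⟩ : ∃ w : TangentSpace 𝓘(ℝ, V) x, w ≠ 0 := exists_ne (α := V) 0
  obtain ⟨W, hW⟩ := exists_sec (V := V) (F := V) (E := fun x : M => TangentSpace 𝓘(ℝ, V) x) x w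
  have hWs : SmoothField (fun y => W y) := W.contMDiff
  have h2 : (2 : WithTop ℕ∞) ≤ ∞ := WithTop.coe_le_coe.2 (le_top : (2 : ℕ∞) ≤ ⊤)
  have h3 : (3 : WithTop ℕ∞) ≤ ∞ := WithTop.coe_le_coe.2 (le_top : (3 : ℕ∞) ≤ ⊤)
  have : IsManifold 𝓘(ℝ, V) (minSmoothness ℝ 3) M :=
    .of_le (n := ∞) (by simpa [minSmoothness_of_isRCLikeNormedField] using h3)
  have : IsManifold 𝓘(ℝ, V) 2 M := .of_le (n := ∞) h2
  have m2 : minSmoothness ℝ 2 ≤ (∞ : WithTop ℕ∞) := by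
    simpa [minSmoothness_of_isRCLikeNormedField] using h2
  have hfW : SmoothField (f • fun y => W y) := hf.smul_section hWs
  have key := VectorField.leibniz_identity_mlieBracket_apply (x := x)
    (hX.of_le m2 x) (hY.of_le m2 x) (hfW.of_le m2 x)
  have md {Z : ∀ x : M, TangentSpace 𝓘(ℝ, V) x} (hZ : SmoothField Z) (y : M) :
    MDiffAt (T% Z) y := hZ.mdifferentiable (by simp) y
  have mdf {g : M → ℝ} (hg : ContMDiff 𝓘(ℝ, V) 𝓘(ℝ, ℝ) ∞ g) (y : M) :
    MDiffAt g y := hg.mdifferentiable (by simp) y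
  have hXW := hX.lieBracket hWs
  have hYW := hY.lieBracket hWs
  have e (Z : ∀ x : M, TangentSpace 𝓘(ℝ, V) x) :
      VectorField.mlieBracket 𝓘(ℝ, V) Z (f • fun y => W y) =
        (fun y => mvfderiv 𝓘(ℝ, V) f y (Z y)) • (fun y => W y)
          + f • VectorField.mlieBracket 𝓘(ℝ, V) Z (fun y => W y) := by
    ext y
    exact VectorField.mlieBracket_smul_right (mdf hf y) (md hWs y)
  have e2 {Z Z' : ∀ x : M, TangentSpace 𝓘(ℝ, V) x} (hZ : SmoothField Z) (hZ' : SmoothField Z') :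
      VectorField.mlieBracket 𝓘(ℝ, V) Z' (VectorField.mlieBracket 𝓘(ℝ, V) Z (f • fun y => W y)) x =
       mvfderiv 𝓘(ℝ, V) (fun y => mvfderiv 𝓘(ℝ, V) f y (Z y)) x (Z' x) • W x
        + mvfderiv 𝓘(ℝ, V) f x (Z x) • VectorField.mlieBracket 𝓘(ℝ, V) Z' (fun y => W y) x
        + (mvfderiv 𝓘(ℝ, V) f x (Z' x) • VectorField.mlieBracket 𝓘(ℝ, V) Z (fun y => W y) x
        + f x • VectorField.mlieBracket 𝓘(ℝ, V) Z'
            (VectorField.mlieBracket 𝓘(ℝ, V) Z (fun y => W y)) x) := by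
    have hZW := hZ.lieBracket hWs
    have hd := contMDiff_dir hf hZ
    rw [e, VectorField.mlieBracket_add_right (md (hd.smul_section hWs) x)
      (md (hf.smul_section hZW) x), VectorField.mlieBracket_smul_right (mdf hd x) (md hWs x),
      VectorField.mlieBracket_smul_right (mdf hf x) (md hZW x)]
  rw [e2 hY hX, e2 hX hY, e] at key
  have key2 := VectorField.leibniz_identity_mlieBracket_apply (x := x)
    (hX.of_le m2 x) (hY.of_le m2 x) (hWs.of_le m2 x)
  rw [key2] at key
  simp only [Pi.add_apply, Pi.smul_apply', hW] at key
  have : (mvfderiv 𝓘(ℝ, V) f x (VectorField.mlieBracket 𝓘(ℝ, V) X Y x) -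
      (mvfderiv 𝓘(ℝ, V) (fun y => mvfderiv 𝓘(ℝ, V) f y (Y y)) x (X x)
      - mvfderiv 𝓘(ℝ, V) (fun y => mvfderiv 𝓘(ℝ, V) f y (X y)) x (Y x))) •
      w = 0 := by
    rw [sub_smul, sub_smul, sub_eq_zero]
    linear_combination (norm := module) (-1 : ℝ) • key
  rcases smul_eq_zero.1 this with h | h
  · exact sub_eq_zero.1 h
  · exact absurd h hw

lemma mvfderiv_congr {G : Type*} [NormedAddCommGroup G] [NormedSpace ℝ G] {f g : M → G} {x : M}
    (h : f =ᶠ[𝓝 x] g) : mvfderiv 𝓘(ℝ, V) f x = mvfderiv 𝓘(ℝ, V) g x := by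
  ext v
  exact DFunLike.congr_fun h.mfderiv_eq v

variable (V F E)

/-- A section read in the preferred local trivialization at `x`. -/
def localRep (x : M) (u : Sec V F E) : M → F := fun y => (trivializationAt F E x ⟨y, u y⟩).2


lemma mdiff_localRep (x : M) (u : Sec V F E) : MDiffAt (localRep V F E x u) x :=
  (((trivializationAt F E x).contMDiffAt_section_iff
    (FiberBundle.mem_baseSet_trivializationAt' x)).1 (u.contMDiff x)).mdifferentiableAt (by simp)

lemma dlocalRep_add (x : M) (u v : Sec V F E) :
    mvfderiv 𝓘(ℝ, V) (localRep V F E x (u + v)) x =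
      mvfderiv 𝓘(ℝ, V) (localRep V F E x u) x + mvfderiv 𝓘(ℝ, V) (localRep V F E x v) x := by
  rw [← mvfderiv_add (mdiff_localRep V F E x u) (mdiff_localRep V F E x v)]
  refine mvfderiv_congr (eventually_of_mem ((trivializationAt F E x).open_baseSet.mem_nhds
    (FiberBundle.mem_baseSet_trivializationAt' x)) fun y hy => ?_)
  exact ((trivializationAt F E x).linear ℝ hy).1 _ _

lemma dlocalRep_fmul (x : M) (f : Fn V M) (u : Sec V F E) :
    mvfderiv 𝓘(ℝ, V) (localRep V F E x (fmul f u)) x =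
      f x • mvfderiv 𝓘(ℝ, V) (localRep V F E x u) x +
        (mvfderiv 𝓘(ℝ, V) f x).smulRight (localRep V F E x u x) := by
  rw [← mvfderiv_smul (f.contMDiff.mdifferentiable (by simp) x) (mdiff_localRep V F E x u)]
  refine mvfderiv_congr (eventually_of_mem ((trivializationAt F E x).open_baseSet.mem_nhds
    (FiberBundle.mem_baseSet_trivializationAt' x)) fun y hy => ?_)
  exact ((trivializationAt F E x).linear ℝ hy).2 _ _

lemma dlocalRep_smul (x : M) (c : ℝ) (u : Sec V F E) :
    mvfderiv 𝓘(ℝ, V) (localRep V F E x (c • u)) x =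
      c • mvfderiv 𝓘(ℝ, V) (localRep V F E x u) x := by
  have h := dlocalRep_fmul V F E x ⟨fun _ => c, contMDiff_const⟩ u
  have h0 : mvfderiv 𝓘(ℝ, V) (fun _ : M => c) x = 0 := mvfderiv_const c
  have h1 : fmul ⟨fun _ => c, contMDiff_const⟩ u = c • u := rfl
  rw [h1] at h
  rw [h]
  ext v
  simp [h0]

/-- The sections whose first jet at `x` vanishes: their value at `x` is zero, and so is the
derivative at `x` of their local representative. -/
def jetZero (x : M) : Submodule ℝ (Sec V F E) where
  carrier := {u | u x = 0 ∧ mvfderiv 𝓘(ℝ, V) (localRep V F E x u) x = 0}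
  zero_mem' := by
    refine ⟨rfl, ?_⟩
    have := dlocalRep_smul V F E x 0 0
    simpa using this
  add_mem' {u v} hu hv := ⟨by simp [hu.1, hv.1], by rw [dlocalRep_add, hu.2, hv.2, add_zero]⟩
  smul_mem' c u hu := ⟨by simp [hu.1], by rw [dlocalRep_smul, hu.2, smul_zero]⟩

/-- The fibre at `x` of the first jet bundle `𝔍E`: sections modulo those with zero 1-jet. -/
abbrev Jet (x : M) : Type _ := Sec V F E ⧸ jetZero V F E x

/-- The fibre at `x` of the gauge Lie algebroid `𝔇E` (covariant differential operators):
linear maps `δ : Γ(E) → E_x` together with a symbol `X ∈ T_xM` such that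
`δ(fu) = f(x) δ(u) + X(f) u(x)`. The symbol is kept as part of the datum so that
`0 → gl(E) → 𝔇E → TM → 0` is exact also when `E` has rank zero. -/
def derFiber (x : M) : Submodule ℝ ((Sec V F E →ₗ[ℝ] E x) × TangentSpace 𝓘(ℝ, V) x) where
  carrier := {p | ∀ (f : Fn V M) (u : Sec V F E),
    p.1 (fmul f u) = f x • p.1 u + mvfderiv 𝓘(ℝ, V) f x p.2 • u x}
  zero_mem' f u := by simp
  add_mem' {p q} hp hq f u := by
    simp only [Prod.fst_add, Prod.snd_add, LinearMap.add_apply, map_add, hp f u, hq f u]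
    module
  smul_mem' c p hp f u := by
    simp only [Prod.smul_fst, Prod.smul_snd, LinearMap.smul_apply, map_smul, hp f u, smul_eq_mul]
    module

/-- The fibre at `x` of the gauge Lie algebroid. -/
abbrev Der (x : M) : Type _ := derFiber V F E x

variable {V F E}

/-- The derivative of a section at `x` by an element of `𝔇E` at `x`. -/
def Der.app {x : M} (δ : Der V F E x) : Sec V F E →ₗ[ℝ] E x := δ.1.1

/-- The symbol `𝕛(δ)`. -/
def Der.symb {x : M} (δ : Der V F E x) : TangentSpace 𝓘(ℝ, V) x := δ.1.2


lemma Der.leibniz {x : M} (δ : Der V F E x) (f : Fn V M) (u : Sec V F E) :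
    δ.app (fmul f u) = f x • δ.app u + mvfderiv 𝓘(ℝ, V) f x δ.symb • u x := δ.2 f u

lemma Der.ext' {x : M} {δ ε : Der V F E x} (h : ∀ u, δ.app u = ε.app u) (h' : δ.symb = ε.symb) :
    δ = ε := Subtype.ext (Prod.ext (LinearMap.ext h) h')


lemma Der.symb_sum {x : M} {k : ℕ} (δ : Fin k → Der V F E x) :
    (∑ i, δ i).symb = ∑ i, (δ i).symb :=
  map_sum (LinearMap.snd ℝ _ _ ∘ₗ (derFiber V F E x).subtype) δ Finset.univ

lemma Der.symb_smul {x : M} (c : ℝ) (δ : Der V F E x) : (c • δ).symb = c • δ.symb := rfl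

lemma Der.app_sum {x : M} {k : ℕ} (δ : Fin k → Der V F E x) (u : Sec V F E) :
    (∑ i, δ i).app u = ∑ i, (δ i).app u :=
  map_sum (LinearMap.applyₗ u ∘ₗ LinearMap.fst ℝ _ _ ∘ₗ (derFiber V F E x).subtype) δ Finset.univ

lemma Der.app_smul {x : M} (c : ℝ) (δ : Der V F E x) (u : Sec V F E) :
    (c • δ).app u = c • δ.app u := rfl

variable (V F E) in
lemma exists_bump (x : M) {U : Set M} (hU : U ∈ 𝓝 x) :
    ∃ χ : Fn V M, tsupport χ ⊆ U ∧ (χ : M → ℝ) =ᶠ[𝓝 x] 1 := by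
  obtain ⟨χ, -, hχ⟩ := (SmoothBumpFunction.nhds_basis_tsupport (I := 𝓘(ℝ, V)) x).mem_iff.1 hU
  exact ⟨⟨χ, χ.contMDiff⟩, hχ, χ.eventuallyEq_one⟩

variable (V F E) in
lemma exists_frame (x : M) : ∃ (χ : Fn V M) (c : Fin (Module.finrank ℝ F) → Sec V F E →ₗ[ℝ] Fn V M)
    (s : Fin (Module.finrank ℝ F) → Sec V F E),
    (χ : M → ℝ) =ᶠ[𝓝 x] 1 ∧ (∀ u, fmul χ u = ∑ j, fmul (c j u) (s j)) ∧
    (∀ j f u, c j (fmul f u) = f * c j u) ∧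
    (∀ j, ∀ u ∈ jetZero V F E x, c j u x = 0 ∧ mvfderiv 𝓘(ℝ, V) (c j u) x = 0) := by
  have : ContMDiffVectorBundle 1 F E 𝓘(ℝ, V) := inferInstance
  set e := trivializationAt F E x with he
  set b := Module.finBasis ℝ F
  have hx : x ∈ e.baseSet := FiberBundle.mem_baseSet_trivializationAt' x
  obtain ⟨χ, hχ, hχ1⟩ := exists_bump V x (e.open_baseSet.mem_nhds hx)
  have csm (j) (u : Sec V F E) : ContMDiff 𝓘(ℝ, V) 𝓘(ℝ, ℝ) ∞
      (fun y => χ y • e.localFrameCoeff 𝓘(ℝ, V) b j y (u y)) := by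
    refine contMDiff_of_tsupport fun y hy => ?_
    have hy : y ∈ e.baseSet := hχ (tsupport_smul_subset_left _ _ hy)
    exact (χ.contMDiff y).smul (contMDiffAt_localFrameCoeff b hy (u.contMDiff y) j)
  let c (j) : Sec V F E →ₗ[ℝ] Fn V M :=
    { toFun u := ⟨_, csm j u⟩
      map_add' u v := by
        ext y
        change χ y * _ = χ y * _ + χ y * _
        simp [mul_add]
      map_smul' r u := by
        ext y
        change χ y * _ = r * (χ y * _)
        simp [mul_left_comm] }
  have hc (j u y) : c j u y = χ y * e.localFrameCoeff 𝓘(ℝ, V) b j y (u y) := rfl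
  refine ⟨χ * χ, c, fun j => ⟨_, ContMDiffOn.smul_section_of_tsupport χ.contMDiff.contMDiffOn
    e.open_baseSet hχ (e.contMDiffOn_localFrame_baseSet ∞ b j)⟩, ?_, ?_, ?_, ?_⟩
  · filter_upwards [hχ1] with y hy
    simp [hy]
  · intro u
    ext y
    have hs : (∑ j, fmul (c j u) ⟨_, ContMDiffOn.smul_section_of_tsupport χ.contMDiff.contMDiffOn
        e.open_baseSet hχ (e.contMDiffOn_localFrame_baseSet ∞ b j)⟩ : Sec V F E) y =
        ∑ j, c j u y • χ y • e.localFrame b j y := by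
      change ContMDiffSection.coeAddHom 𝓘(ℝ, V) F ∞ E _ y = _
      rw [map_sum, Finset.sum_apply]
      rfl
    rw [hs]
    change (χ y * χ y) • u y = _
    by_cases hy : y ∈ e.baseSet
    · rw [e.eq_sum_localFrameCoeff_smul (I := 𝓘(ℝ, V)) (b := b) (s := fun y => u y) hy,
        Finset.smul_sum]
      refine Finset.sum_congr rfl fun j _ => ?_
      rw [hc, smul_smul, smul_smul]
      congr 1
      ring
    · have : χ y = 0 := image_eq_zero_of_notMem_tsupport fun h => hy (hχ h)
      simp [this]
  · intro j f u
    ext y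
    change _ = f y * c j u y
    rw [hc, hc, fmul_apply, map_smul, smul_eq_mul]
    ring
  · intro j u hu
    refine ⟨by rw [hc, hu.1]; simp, ?_⟩
    have h1 : (c j u : M → ℝ) =ᶠ[𝓝 x]
        (LinearMap.toContinuousLinearMap (b.coord j)) ∘ localRep V F E x u := by
      filter_upwards [hχ1, e.open_baseSet.mem_nhds hx] with y hy hy'
      rw [hc, hy, e.localFrameCoeff_eq_coeff (s := fun y => u y) hy']
      simp [localRep, he]
    rw [mvfderiv_congr h1, mvfderiv_comp x
      (LinearMap.toContinuousLinearMap (b.coord j)).mdifferentiableAt (mdiff_localRep V F E x u)]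
    ext v
    have h2 : mfderiv 𝓘(ℝ, V) 𝓘(ℝ, F) (localRep V F E x u) x v = 0 :=
      DFunLike.congr_fun hu.2 v
    rw [ContinuousLinearMap.comp_apply, h2]
    simp

lemma Der.app_eq_zero {x : M} (δ : Der V F E x) {u : Sec V F E} (hu : u ∈ jetZero V F E x) :
    δ.app u = 0 := by
  obtain ⟨χ, c, s, hχ, h1, -, h2⟩ := exists_frame V F E x
  have e1 := δ.leibniz χ u
  rw [h1, map_sum, hu.1, hχ.eq_of_nhds] at e1
  simpa [δ.leibniz, h2 _ u hu] using e1.symm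

/-- Elements of `𝔇E` at `x` only see the germ of a section at `x`. -/
lemma Der.app_congr {x : M} (δ : Der V F E x) {u v : Sec V F E} (h : ∀ᶠ y in 𝓝 x, u y = v y) :
    δ.app u = δ.app v := by
  obtain ⟨χ, h1, h2⟩ := exists_bump V x h
  have e0 : fmul χ (u - v) = 0 := by
    ext y
    by_cases hy : u y = v y
    · simp [hy]
    · have : χ y = 0 := image_eq_zero_of_notMem_tsupport fun h => hy (h1 h)
      simp [this]
  have e1 := δ.leibniz χ (u - v)
  have e2 : (u - v : Sec V F E) x = 0 := by simp [h.self_of_nhds]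
  rw [e0, e2, h2.eq_of_nhds, map_zero, map_sub] at e1
  rw [smul_zero, add_zero, Pi.one_apply, one_smul] at e1
  exact sub_eq_zero.1 e1.symm


variable (V F E) in
/-- Smooth sections of `𝔇E`: the symbol is a smooth vector field, and smooth sections of `E` are
mapped to smooth sections. -/
def derSec : Submodule ℝ (∀ x : M, Der V F E x) where
  carrier := {d | SmoothField (fun x => (d x).symb) ∧
    ∀ u : Sec V F E, ContMDiff 𝓘(ℝ, V) (𝓘(ℝ, V).prod 𝓘(ℝ, F)) ∞
      (fun x => TotalSpace.mk' F x ((d x).app u))}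
  zero_mem' := ⟨(0 : Sec V V (fun x : M => TangentSpace 𝓘(ℝ, V) x)).contMDiff,
    fun _ => (0 : Sec V F E).contMDiff⟩
  add_mem' hd ht := ⟨hd.1.add_section ht.1, fun u => (hd.2 u).add_section (ht.2 u)⟩
  smul_mem' _ _ hd := ⟨hd.1.const_smul_section, fun u => (hd.2 u).const_smul_section⟩

/-- A smooth section of `𝔇E` acts on smooth sections of `E`. -/
def act (d : derSec V F E) : Sec V F E →ₗ[ℝ] Sec V F E where
  toFun u := ⟨fun x => (d.1 x).app u, d.2.2 u⟩
  map_add' u v := by ext x; simp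
  map_smul' c u := by ext x; simp

/-- The function `X(f)`, where `X` is the symbol of a smooth section of `𝔇E`. -/
def dirFn (d : derSec V F E) (f : Fn V M) : Fn V M :=
  ⟨fun x => mvfderiv 𝓘(ℝ, V) f x (d.1 x).symb, contMDiff_dir f.contMDiff d.2.1⟩

lemma act_apply (d : derSec V F E) (u : Sec V F E) (x : M) : act d u x = (d.1 x).app u := rfl

lemma act_fmul (d : derSec V F E) (f : Fn V M) (u : Sec V F E) :
    act d (fmul f u) = fmul f (act d u) + fmul (dirFn d f) u := by
  ext x
  exact (d.1 x).leibniz f u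


/-- The commutator bracket `[·,·]_𝔇` on `Γ(𝔇E)`. -/
def derBracket (d t : derSec V F E) : derSec V F E :=
  ⟨fun x => ⟨((d.1 x).app ∘ₗ act t - (t.1 x).app ∘ₗ act d,
      VectorField.mlieBracket 𝓘(ℝ, V) (fun y => (d.1 y).symb) (fun y => (t.1 y).symb) x), by
    intro f u
    have h := dir_lieBracket f.contMDiff d.2.1 t.2.1 x
    change (d.1 x).app (act t (fmul f u)) - (t.1 x).app (act d (fmul f u)) =
      f x • ((d.1 x).app (act t u) - (t.1 x).app (act d u)) + _ • u x
    rw [h, act_fmul, act_fmul, map_add, map_add, Der.leibniz, Der.leibniz, Der.leibniz, Der.leibniz,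
      act_apply, act_apply]
    change _ + (_ + mvfderiv 𝓘(ℝ, V) (fun y => mvfderiv 𝓘(ℝ, V) f y (t.1 y).symb) x (d.1 x).symb
      • u x) - (_ + (_ + mvfderiv 𝓘(ℝ, V) (fun y => mvfderiv 𝓘(ℝ, V) f y (d.1 y).symb) x
      (t.1 x).symb • u x)) = _
    change _ + (mvfderiv 𝓘(ℝ, V) f x (t.1 x).symb • _ + _) -
      (_ + (mvfderiv 𝓘(ℝ, V) f x (d.1 x).symb • _ + _)) = _
    module⟩,
  d.2.1.lieBracket t.2.1, fun u => (act d (act t u) - act t (act d u)).contMDiff⟩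


/-- The `E`-valued pairing `⟨[u]_x, δ⟩ = δ(u)` between `𝔍E` and `𝔇E`. -/
def pairing (x : M) : Jet V F E x →ₗ[ℝ] Der V F E x →ₗ[ℝ] E x :=
  (jetZero V F E x).liftQ
    { toFun u :=
        { toFun δ := δ.app u
          map_add' _ _ := rfl
          map_smul' _ _ := rfl }
      map_add' u v := by ext δ; exact map_add δ.app _ _
      map_smul' c u := by ext δ; exact map_smul δ.app _ _ }
    (fun _ hu => LinearMap.ext fun δ => δ.app_eq_zero hu)

/-- The first jet `[u]_x`; as a function of `x` it is the section `𝕕u` of `𝔍E`. -/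
def jet (u : Sec V F E) (x : M) : Jet V F E x := (jetZero V F E x).mkQ u

lemma pairing_jet (u : Sec V F E) {x : M} (δ : Der V F E x) : pairing x (jet u x) δ = δ.app u := rfl

/-- The pairing is nondegenerate in its first argument. -/
lemma jet_ext {x : M} {j k : Jet V F E x} (h : ∀ δ : Der V F E x, pairing x j δ = pairing x k δ) :
    j = k := by
  suffices H : ∀ j : Jet V F E x, (∀ δ : Der V F E x, pairing x j δ = 0) → j = 0 from
    sub_eq_zero.1 (H _ fun δ => by simp [h δ])
  intro j hj
  obtain ⟨u, rfl⟩ := (jetZero V F E x).mkQ_surjective j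
  have hx : x ∈ (trivializationAt F E x).baseSet := FiberBundle.mem_baseSet_trivializationAt' x
  refine (Submodule.Quotient.mk_eq_zero _).2 ⟨?_, ?_⟩
  · exact hj ⟨(⟨⟨fun v => v x, fun _ _ => rfl⟩, fun _ _ => rfl⟩, 0), fun f v => by simp⟩
  · ext X
    let L := ((trivializationAt F E x).linearEquivAt (R := ℝ) x hx).symm
    have h1 := hj ⟨(L.toLinearMap ∘ₗ
      ⟨⟨fun v => mvfderiv 𝓘(ℝ, V) (localRep V F E x v) x X, fun v w => by
        rw [dlocalRep_add]; rfl⟩, fun c v => by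
        change mvfderiv 𝓘(ℝ, V) (localRep V F E x (c • v)) x X = _
        rw [dlocalRep_smul]; rfl⟩, X), fun f v => by
          change L (mvfderiv 𝓘(ℝ, V) (localRep V F E x (fmul f v)) x X) = f x •
            L (mvfderiv 𝓘(ℝ, V) (localRep V F E x v) x X) + _
          rw [dlocalRep_fmul]
          change L (f x • _ + mvfderiv 𝓘(ℝ, V) f x X • localRep V F E x v x) = _
          rw [map_add, map_smul, map_smul]
          congr 2
          exact ((trivializationAt F E x).linearEquivAt (R := ℝ) x hx).symm_apply_apply _⟩
    have h2 : L (mvfderiv 𝓘(ℝ, V) (localRep V F E x u) x X) = 0 := h1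
    simpa using h2

/-- Every element of `𝔇E` at `x` is the value of a smooth section. -/
lemma exists_derSec {x : M} (δ : Der V F E x) : ∃ d : derSec V F E, d.1 x = δ := by
  obtain ⟨χ, c, s, h1, h2, h3, -⟩ := exists_frame V F E x
  obtain ⟨X, hX⟩ := exists_sec (V := V) (F := V) (E := fun x : M => TangentSpace 𝓘(ℝ, V) x) x δ.symb
  choose w hw using fun j => exists_sec (V := V) (F := F) x (δ.app (s j))
  let X' (f : Fn V M) : Fn V M :=
    ⟨fun y => mvfderiv 𝓘(ℝ, V) f y (X y), contMDiff_dir f.contMDiff X.contMDiff⟩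
  have X'add (f g : Fn V M) : X' (f + g) = X' f + X' g := by
    ext y
    exact DFunLike.congr_fun (mvfderiv_add (f.contMDiff.mdifferentiable (by simp) y)
      (g.contMDiff.mdifferentiable (by simp) y)) (X y)
  have X'mul (f g : Fn V M) : X' (f * g) = f * X' g + X' f * g := by
    ext y
    have := DFunLike.congr_fun (mvfderiv_mul (f.contMDiff.mdifferentiable (by simp) y)
      (g.contMDiff.mdifferentiable (by simp) y)) (X y)
    change mvfderiv 𝓘(ℝ, V) (⇑f * ⇑g) y (X y) = f y * mvfderiv 𝓘(ℝ, V) g y (X y) +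
      mvfderiv 𝓘(ℝ, V) f y (X y) * g y
    rw [this]
    simp [mul_comm]
  have X'smul (r : ℝ) (g : Fn V M) : X' (r • g) = r • X' g := by
    ext y
    have := DFunLike.congr_fun (mvfderiv_smul (a := fun _ : M => r) mdifferentiableAt_const
      (g.contMDiff.mdifferentiable (by simp) y)) (X y)
    have h0 : mvfderiv 𝓘(ℝ, V) (fun _ : M => r) y = 0 := mvfderiv_const r
    rw [h0] at this
    refine Eq.trans this ?_
    rw [Fn.smul_apply]
    simp [X']
  let D (u : Sec V F E) : Sec V F E := ∑ j, (fmul (X' (c j u)) (s j) + fmul (c j u) (w j))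
  have hD (u y) : D u y = ∑ j, (X' (c j u) y • s j y + c j u y • w j y) := by
    change ContMDiffSection.coeAddHom 𝓘(ℝ, V) F ∞ E _ y = _
    rw [map_sum, Finset.sum_apply]
    rfl
  have hcs (u y) : χ y • u y = ∑ j, c j u y • s j y := by
    have := congrArg (fun v : Sec V F E => v y) (h2 u)
    change χ y • u y = ContMDiffSection.coeAddHom 𝓘(ℝ, V) F ∞ E _ y at this
    rw [this, map_sum, Finset.sum_apply]
    rfl
  refine ⟨⟨fun y => ⟨(⟨⟨fun u => D u y, fun u v => ?_⟩, fun r u => ?_⟩, χ y • X y), ?_⟩, ?_, ?_⟩, ?_⟩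
  · simp only [hD, ← Finset.sum_add_distrib, map_add, X'add]
    refine Finset.sum_congr rfl fun j _ => ?_
    rw [Fn.add_apply, Fn.add_apply]
    module
  · simp only [hD, Finset.smul_sum, map_smul, X'smul, RingHom.id_apply]
    refine Finset.sum_congr rfl fun j _ => ?_
    rw [Fn.smul_apply, Fn.smul_apply]
    module
  · intro f u
    change D (fmul f u) y = f y • D u y + mvfderiv 𝓘(ℝ, V) f y (χ y • X y) • u y
    rw [map_smul, smul_eq_mul, mul_comm, mul_smul, hcs, hD, hD, Finset.smul_sum, Finset.smul_sum,
      ← Finset.sum_add_distrib]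
    refine Finset.sum_congr rfl fun j _ => ?_
    rw [h3, X'mul]
    rw [Fn.add_apply, Fn.mul_apply, Fn.mul_apply, Fn.mul_apply]
    change _ = _ + X' f y • _
    module
  · exact (fmul χ X).contMDiff
  · exact fun u => (D u).contMDiff
  · refine Der.ext' (fun u => ?_) ?_
    · change D u x = _
      have e := δ.leibniz χ u
      have e0 : mvfderiv 𝓘(ℝ, V) χ x = 0 := by
        rw [mvfderiv_congr h1]
        exact mvfderiv_const (1 : ℝ)
      rw [h2, map_sum, h1.eq_of_nhds, e0] at e
      simp only [Pi.one_apply, one_smul, _root_.zero_apply, zero_smul, add_zero] at e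
      rw [← e, hD]
      refine Finset.sum_congr rfl fun j _ => ?_
      rw [δ.leibniz, hw, add_comm, ← hX]
      rfl
    · change χ x • X x = _
      rw [h1.eq_of_nhds, hX]
      simp


variable (V F E) in
/-- Smooth sections of `𝔍E`: locally finite combinations `∑ f_i 𝕕u_i` with `f_i` smooth functions
and `u_i` smooth sections of `E`. -/
def jetSec : Submodule ℝ (∀ x : M, Jet V F E x) where
  carrier := {μ | ∀ x, ∃ (k : ℕ) (f : Fin k → Fn V M) (u : Fin k → Sec V F E),
    ∀ᶠ y in 𝓝 x, μ y = ∑ i, f i y • jet (u i) y}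
  zero_mem' x := ⟨0, Fin.elim0, Fin.elim0, by simp⟩
  add_mem' {μ ν} hμ hν x := by
    obtain ⟨k, f, u, h⟩ := hμ x
    obtain ⟨l, g, v, h'⟩ := hν x
    refine ⟨k + l, Fin.append f g, Fin.append u v, ?_⟩
    filter_upwards [h, h'] with y hy hy'
    simp [Fin.sum_univ_add, hy, hy']
  smul_mem' c μ hμ x := by
    obtain ⟨k, f, u, h⟩ := hμ x
    refine ⟨k, fun i => c • f i, u, ?_⟩
    filter_upwards [h] with y hy
    simp only [Pi.smul_apply, hy, Finset.smul_sum, smul_smul, Fn.smul_apply]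

/-- The section `𝕕u` of `𝔍E` (the first jet prolongation of `u`). -/
def dJet (u : Sec V F E) : jetSec V F E :=
  ⟨jet u, fun _ => ⟨1, fun _ => 1, fun _ => u, by simp⟩⟩

/-- The pairing of smooth sections of `𝔍E` and `𝔇E`, a smooth section of `E`. -/
def pairSec (μ : jetSec V F E) (d : derSec V F E) : Sec V F E :=
  ⟨fun x => pairing x (μ.1 x) (d.1 x), fun x => by
    obtain ⟨k, f, u, h⟩ := μ.2 x
    refine ((ContMDiff.sum_section (s := Finset.univ)
      fun i _ => (fmul (f i) (act d (u i))).contMDiff) x).congr_of_eventuallyEq ?_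
    filter_upwards [h] with y hy
    simp only [hy, map_sum, LinearMap.sum_apply, map_smul, LinearMap.smul_apply, pairing_jet]
    rfl⟩

/-- The value at `x` of `∑ X(f_i) 𝕕u_i + f_i 𝕕(d u_i)`, where `X` is the symbol of `d`. -/
def lieValue (d : derSec V F E) {k : ℕ} (f : Fin k → Fn V M) (u : Fin k → Sec V F E) (x : M) :
    Jet V F E x :=
  ∑ i, dirFn d (f i) x • jet (u i) x + ∑ i, f i x • jet (act d (u i)) x

lemma pairing_lieValue (d t : derSec V F E) (μ : jetSec V F E) {x : M} {k : ℕ}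
    {f : Fin k → Fn V M} {u : Fin k → Sec V F E}
    (h : ∀ᶠ y in 𝓝 x, μ.1 y = ∑ i, f i y • jet (u i) y) :
    pairing x (lieValue d f u x) (t.1 x) =
      act d (pairSec μ t) x - pairSec μ (derBracket d t) x := by
  have h1 : (d.1 x).app (pairSec μ t) = (d.1 x).app (∑ i, fmul (f i) (act t (u i))) := by
    refine (d.1 x).app_congr ?_
    filter_upwards [h] with y hy
    change pairing y (μ.1 y) (t.1 y) = ContMDiffSection.coeAddHom 𝓘(ℝ, V) F ∞ E _ y
    rw [map_sum, Finset.sum_apply, hy]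
    simp only [map_sum, LinearMap.sum_apply, map_smul, LinearMap.smul_apply, pairing_jet]
    rfl
  have h2 : pairSec μ (derBracket d t) x =
      ∑ i, f i x • (act d (act t (u i)) x - act t (act d (u i)) x) := by
    change pairing x (μ.1 x) ((derBracket d t).1 x) = _
    rw [h.self_of_nhds]
    simp only [map_sum, LinearMap.sum_apply, map_smul, LinearMap.smul_apply, pairing_jet]
    rfl
  rw [act_apply, h1, h2, map_sum, ← Finset.sum_sub_distrib, lieValue, ← Finset.sum_add_distrib]
  simp only [map_sum, LinearMap.sum_apply, map_add, map_smul, LinearMap.add_apply,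
    LinearMap.smul_apply, pairing_jet, Der.leibniz]
  refine Finset.sum_congr rfl fun i _ => ?_
  change dirFn d (f i) x • act t (u i) x + f i x • act t (act d (u i)) x =
    f i x • act d (act t (u i)) x + dirFn d (f i) x • act t (u i) x - _
  module

lemma lieValue_unique (d : derSec V F E) (μ : jetSec V F E) {x : M} {k l : ℕ}
    {f : Fin k → Fn V M} {u : Fin k → Sec V F E} {g : Fin l → Fn V M} {v : Fin l → Sec V F E}
    (h : ∀ᶠ y in 𝓝 x, μ.1 y = ∑ i, f i y • jet (u i) y)
    (h' : ∀ᶠ y in 𝓝 x, μ.1 y = ∑ i, g i y • jet (v i) y) :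
    lieValue d f u x = lieValue d g v x := by
  refine jet_ext fun δ => ?_
  obtain ⟨t, rfl⟩ := exists_derSec δ
  rw [pairing_lieValue d t μ h, pairing_lieValue d t μ h']

/-- The Lie derivative `𝔏_d μ` of a smooth section of `𝔍E`: if `μ = ∑ f_i 𝕕u_i` near `x`, then
`(𝔏_d μ)_x = ∑ X(f_i) [u_i]_x + f_i(x) [d u_i]_x`. It is characterized by the Leibniz rule
`⟨𝔏_d μ, t⟩ = d⟨μ, t⟩ - ⟨μ, [d, t]⟩`, see `pairSec_lieDeriv`. -/
def lieDeriv (d : derSec V F E) (μ : jetSec V F E) : jetSec V F E :=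
  ⟨fun x => lieValue d (μ.2 x).choose_spec.choose (μ.2 x).choose_spec.choose_spec.choose x,
  fun x => by
    obtain ⟨k, f, u, h⟩ := μ.2 x
    refine ⟨k + k, Fin.append (fun i => dirFn d (f i)) f, Fin.append u (fun i => act d (u i)), ?_⟩
    filter_upwards [eventually_eventually_nhds.2 h] with y hy
    rw [lieValue_unique d μ (μ.2 y).choose_spec.choose_spec.choose_spec hy]
    rw [Fin.sum_univ_add]
    simp only [Fin.append_left, Fin.append_right]
    rfl⟩

lemma pairSec_lieDeriv (d t : derSec V F E) (μ : jetSec V F E) :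
    pairSec (lieDeriv d μ) t = act d (pairSec μ t) - pairSec μ (derBracket d t) := by
  ext x
  exact pairing_lieValue d t μ (μ.2 x).choose_spec.choose_spec.choose_spec

/-! ### Bundle maps -/

/-- A vector bundle map over the identity of `M` between bundles with fibres `P x`, `Q x` and
modules of smooth sections `ΓP`, `ΓQ`: a family of linear maps taking smooth sections to smooth
sections. -/
@[ext] structure BundleMap {M : Type*} {P Q : M → Type*} [∀ x, AddCommGroup (P x)]
    [∀ x, Module ℝ (P x)] [∀ x, AddCommGroup (Q x)] [∀ x, Module ℝ (Q x)]
    (ΓP : Submodule ℝ (∀ x, P x)) (ΓQ : Submodule ℝ (∀ x, Q x)) where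
  toFun : ∀ x, P x →ₗ[ℝ] Q x
  smooth : ∀ s ∈ ΓP, (fun x => toFun x (s x)) ∈ ΓQ

/-- The map on smooth sections induced by a bundle map. -/
def BundleMap.onSec {M : Type*} {P Q : M → Type*} [∀ x, AddCommGroup (P x)]
    [∀ x, Module ℝ (P x)] [∀ x, AddCommGroup (Q x)] [∀ x, Module ℝ (Q x)]
    {ΓP : Submodule ℝ (∀ x, P x)} {ΓQ : Submodule ℝ (∀ x, Q x)} (φ : BundleMap ΓP ΓQ) (s : ΓP) :
    ΓQ := ⟨fun x => φ.toFun x (s.1 x), φ.smooth s.1 s.2⟩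

/-- An isomorphism of vector bundles over the identity of `M`. -/
structure BundleIso {M : Type*} {P Q : M → Type*} [∀ x, AddCommGroup (P x)]
    [∀ x, Module ℝ (P x)] [∀ x, AddCommGroup (Q x)] [∀ x, Module ℝ (Q x)]
    (ΓP : Submodule ℝ (∀ x, P x)) (ΓQ : Submodule ℝ (∀ x, Q x)) where
  toMap : BundleMap ΓP ΓQ
  inv : BundleMap ΓQ ΓP
  left_inv : ∀ x p, inv.toFun x (toMap.toFun x p) = p
  right_inv : ∀ x q, toMap.toFun x (inv.toFun x q) = q

/-! ### The omni-Lie algebroid `𝔇E ⊕ 𝔍E` -/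

variable (V F E) in
/-- The fibre of `𝔇E ⊕ 𝔍E` at `x`. -/
abbrev Omni (x : M) : Type _ := Der V F E x × Jet V F E x

variable (V F E) in
/-- Smooth sections of `𝔇E ⊕ 𝔍E`. -/
def omniSec : Submodule ℝ (∀ x : M, Omni V F E x) where
  carrier := {s | (fun x => (s x).1) ∈ derSec V F E ∧ (fun x => (s x).2) ∈ jetSec V F E}
  zero_mem' := ⟨(derSec V F E).zero_mem, (jetSec V F E).zero_mem⟩
  add_mem' hs ht := ⟨(derSec V F E).add_mem hs.1 ht.1, (jetSec V F E).add_mem hs.2 ht.2⟩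
  smul_mem' c _ hs := ⟨(derSec V F E).smul_mem c hs.1, (jetSec V F E).smul_mem c hs.2⟩

/-- The section `d + μ` of `𝔇E ⊕ 𝔍E`. -/
def omniMk (d : derSec V F E) (μ : jetSec V F E) : omniSec V F E :=
  ⟨fun x => (d.1 x, μ.1 x), d.2, μ.2⟩

/-- The `𝔇E`-component of a section (that is, its image under the anchor). -/
def omniFst (s : omniSec V F E) : derSec V F E := ⟨_, s.2.1⟩

/-- The `𝔍E`-component of a section. -/
def omniSnd (s : omniSec V F E) : jetSec V F E := ⟨_, s.2.2⟩

/-- The `E`-valued symmetric pairing `(δ + μ, ε + ν) = ½ (⟨μ, ε⟩ + ⟨ν, δ⟩)`. -/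
def omniPairing {x : M} (e e' : Omni V F E x) : E x :=
  (1 / 2 : ℝ) • (pairing x e.2 e'.1 + pairing x e'.2 e.1)

/-- The bracket `⟦d + μ, r + ν⟧ = [d, r]_𝔇 + 𝔏_d ν - 𝔏_r μ + 𝕕⟨μ, r⟩`. -/
def dorfman (s t : omniSec V F E) : omniSec V F E :=
  omniMk (derBracket (omniFst s) (omniFst t))
    (lieDeriv (omniFst s) (omniSnd t) - lieDeriv (omniFst t) (omniSnd s)
      + dJet (pairSec (omniSnd s) (omniFst t)))

/-- Generalized complex structures on the omni-Lie algebroid of `E`. -/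
structure IsGeneralizedComplex (J : BundleMap (omniSec V F E) (omniSec V F E)) : Prop where
  sq : ∀ (x : M) (e : Omni V F E x), J.toFun x (J.toFun x e) = -e
  orthogonal : ∀ (x : M) (e e' : Omni V F E x),
    omniPairing (J.toFun x e) (J.toFun x e') = omniPairing e e'
  integrable : ∀ s t : omniSec V F E,
    dorfman (J.onSec s) (J.onSec t) - dorfman s t
      - J.onSec (dorfman (J.onSec s) t + dorfman s (J.onSec t)) = 0

/-- The endomorphism of `𝔇E ⊕ 𝔍E` with block matrix `(0, φ; -φ⁻¹, 0)`, that is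
`δ + μ ↦ φ(μ) - φ⁻¹(δ)`. -/
def offDiagonal (φ : BundleIso (jetSec V F E) (derSec V F E)) :
    BundleMap (omniSec V F E) (omniSec V F E) where
  toFun x := LinearMap.prod (φ.toMap.toFun x ∘ₗ LinearMap.snd ℝ _ _)
    (-(φ.inv.toFun x ∘ₗ LinearMap.fst ℝ _ _))
  smooth _ hs := ⟨φ.toMap.smooth _ hs.2, (jetSec V F E).neg_mem (φ.inv.smooth _ hs.1)⟩

/-! ### Lie algebroids -/

variable (V F E) in
/-- A Lie algebroid structure on the vector bundle `E → M`: a Lie bracket on smooth sections and a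
smooth bundle map `a : E → TM`, the anchor, with `[u, f v] = f [u, v] + a(u)(f) v`. (That `a`
intertwines the brackets follows from these axioms.) -/
structure LieAlgebroid where
  bracket : Sec V F E →ₗ[ℝ] Sec V F E →ₗ[ℝ] Sec V F E
  anchor : ∀ x : M, E x →ₗ[ℝ] TangentSpace 𝓘(ℝ, V) x
  skew : ∀ u v, bracket u v = -bracket v u
  jacobi : ∀ u v w, bracket u (bracket v w) = bracket (bracket u v) w + bracket v (bracket u w)
  anchor_smooth : ContMDiff (𝓘(ℝ, V).prod 𝓘(ℝ, F)) 𝓘(ℝ, V).tangent ∞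
    (fun p : TotalSpace F E => (⟨p.proj, anchor p.proj p.snd⟩ : TangentBundle 𝓘(ℝ, V) M))
  leibniz : ∀ (u : Sec V F E) (f : Fn V M) (v : Sec V F E) (x : M),
    bracket u (fmul f v) x = f x • bracket u v x + mvfderiv 𝓘(ℝ, V) f x (anchor x (u x)) • v x

namespace LieAlgebroid

variable (A : LieAlgebroid V F E)

/-- The element `([u, ·]_x, a(u)_x)` of `𝔇E` at `x`. -/
def adAt (x : M) : Sec V F E →ₗ[ℝ] Der V F E x where
  toFun u := ⟨(⟨⟨fun v => A.bracket u v x, fun v w => by simp⟩, fun c v => by simp⟩,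
    A.anchor x (u x)), fun f v => A.leibniz u f v x⟩
  map_add' u v := Der.ext' (fun w => by
    change A.bracket (u + v) w x = A.bracket u w x + A.bracket v w x
    simp) (map_add (A.anchor x) (u x) (v x))
  map_smul' c u := Der.ext' (fun w => by
    change A.bracket (c • u) w x = c • A.bracket u w x
    simp) (map_smul (A.anchor x) c (u x))

lemma smoothField_anchor (u : Sec V F E) : SmoothField (fun x => A.anchor x (u x)) :=
  A.anchor_smooth.comp u.contMDiff

/-- The bundle map `π^♯ : 𝔍E → 𝔇E` with `π^♯(𝕕u) = [u, ·]`. -/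
def piSharp : BundleMap (jetSec V F E) (derSec V F E) where
  toFun x := (jetZero V F E x).liftQ (A.adAt x) fun u hu => Der.ext' (fun v => by
    have h : A.bracket v u x = 0 := (A.adAt x v).app_eq_zero hu
    change A.bracket u v x = 0
    rw [A.skew, ContMDiffSection.coe_neg, Pi.neg_apply, h, neg_zero])
    (by change A.anchor x (u x) = 0; rw [hu.1, map_zero])
  smooth μ hμ := by
    refine ⟨fun x => ?_, fun v x => ?_⟩
    · obtain ⟨k, f, u, h⟩ := hμ x
      refine ((A.smoothField_anchor (∑ i, fmul (f i) (u i))) x).congr_of_eventuallyEq ?_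
      filter_upwards [h] with y hy
      have e : (∑ i, fmul (f i) (u i) : Sec V F E) y = ∑ i, f i y • u i y := by
        change ContMDiffSection.coeAddHom 𝓘(ℝ, V) F ∞ E _ y = _
        rw [map_sum, Finset.sum_apply]
        rfl
      rw [e, hy, map_sum, Der.symb_sum, map_sum]
      simp only [map_smul, Der.symb_smul]
      rfl
    · obtain ⟨k, f, u, h⟩ := hμ x
      refine ((ContMDiff.sum_section (s := Finset.univ)
        fun i _ => (fmul (f i) (A.bracket (u i) v)).contMDiff) x).congr_of_eventuallyEq ?_
      filter_upwards [h] with y hy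
      rw [hy, map_sum, Der.app_sum]
      simp only [map_smul, Der.app_smul]
      rfl

lemma piSharp_jet (u : Sec V F E) (x : M) : A.piSharp.toFun x (jet u x) = A.adAt x u := rfl

end LieAlgebroid

end OmniLie

end

noncomputable section

namespace OmniLie

variable {V : Type*} [NormedAddCommGroup V] [NormedSpace ℝ V] [FiniteDimensional ℝ V]
  {M : Type*} [TopologicalSpace M] [T2Space M] [ChartedSpace V M] [IsManifold 𝓘(ℝ, V) ∞ M]
  {F : Type*} [NormedAddCommGroup F] [NormedSpace ℝ F] [FiniteDimensional ℝ F]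
  {E : M → Type*} [TopologicalSpace (TotalSpace F E)]
  [∀ x, AddCommGroup (E x)] [∀ x, Module ℝ (E x)] [∀ x, TopologicalSpace (E x)]
  [FiberBundle F E] [VectorBundle ℝ F E] [ContMDiffVectorBundle ∞ F E 𝓘(ℝ, V)]

/-! Write π for `π^♯`. The identity `J² = -1` is immediate from the block form. The other two
conditions are properties of π: skew-symmetry for the `E`-valued pairing gives orthogonality, and
compatibility with the brackets gives integrability.

Skew-symmetry, `⟨j, πk⟩ = -⟨k, πj⟩`, is the skew-symmetry of the Lie bracket, because `⟨[u]_x,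
π[v]_x⟩ = [v, u](x)` and every jet at `x` comes from a section (`pairing_piSharp_skew`).

Compatibility is `[πμ, πν]_𝔇 = π{μ, ν}`, where `{μ, ν} = 𝔏_{πμ} ν - 𝔏_{πν} μ + 𝕕⟨μ, πν⟩`
(`derBracket_piSharp`). It is reached in three stages: for `𝕕u, 𝕕v` it is the Jacobi identity; for
`𝕕w, μ` and then for `μ, ν` it follows by evaluating both sides on a section of `E`, using `(πμ)(u)
= -⟨μ, π𝕕u⟩` and the formula that characterizes `𝔏`. No local expansion of μ or ν is needed.

Evaluating on sections suffices because π is invertible: an element of `𝔇E` is then determined by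
its action, so symbols never have to be compared (`der_ext_of_iso`).

Finally, since π is onto, sections can be written `s = πα + μ` and `t = πβ + ν`. All brackets in the
integrability condition become expressions in `{·,·}`, `𝔏` and `𝕕`, and these cancel identically. -/

/-- Sections of `𝔍E` are separated by their pairings with sections of `𝔇E`. -/
lemma jetSec_ext {μ ν : jetSec V F E} (h : ∀ t : derSec V F E, pairSec μ t = pairSec ν t) :
    μ = ν := by
  refine Subtype.ext (funext fun x => jet_ext fun δ => ?_)
  obtain ⟨t, rfl⟩ := exists_derSec δ
  exact DFunLike.congr_fun (h t) x

lemma pairSec_add (μ ν : jetSec V F E) (t : derSec V F E) :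
    pairSec (μ + ν) t = pairSec μ t + pairSec ν t := by
  ext x
  exact LinearMap.map_add₂ (pairing x) (μ.1 x) (ν.1 x) (t.1 x)

lemma pairSec_neg (μ : jetSec V F E) (t : derSec V F E) :
    pairSec (-μ) t = -pairSec μ t := by
  ext x
  exact LinearMap.map_neg₂ (pairing x) (μ.1 x) (t.1 x)

lemma pairSec_sub (μ ν : jetSec V F E) (t : derSec V F E) :
    pairSec (μ - ν) t = pairSec μ t - pairSec ν t := by
  rw [sub_eq_add_neg, pairSec_add, pairSec_neg, ← sub_eq_add_neg]

lemma pairSec_neg_right (μ : jetSec V F E) (t : derSec V F E) :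
    pairSec μ (-t) = -pairSec μ t := by
  ext x
  exact map_neg (pairing x (μ.1 x)) (t.1 x)

lemma pairSec_dJet (u : Sec V F E) (t : derSec V F E) : pairSec (dJet u) t = act t u := rfl

/-- `lieDeriv` is built from a chosen local expression of its argument, so its behaviour under
negation is read off from the pairing formula `pairSec_lieDeriv` and nondegeneracy. -/
lemma lieDeriv_neg (d : derSec V F E) (μ : jetSec V F E) :
    lieDeriv d (-μ) = -lieDeriv d μ := by
  refine jetSec_ext fun t => ?_
  simp only [pairSec_neg, pairSec_lieDeriv, map_neg]
  abel

lemma dJet_neg (u : Sec V F E) : dJet (-u) = -dJet u := by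
  refine jetSec_ext fun t => ?_
  rw [pairSec_neg, pairSec_dJet, pairSec_dJet, map_neg]

lemma act_derBracket (d t : derSec V F E) (u : Sec V F E) :
    act (derBracket d t) u = act d (act t u) - act t (act d u) := rfl

lemma derBracket_skew (d t : derSec V F E) : derBracket d t = -derBracket t d := by
  refine Subtype.ext (funext fun x => Der.ext' (fun u => (neg_sub _ _).symm) ?_)
  exact VectorField.mlieBracket_swap_apply

/-- The bracket `𝔏_{φμ} ν - 𝔏_{φν} μ + 𝕕⟨μ, φν⟩` on sections of `𝔍E` given by a bundle map
`φ : 𝔍E → 𝔇E`. -/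
def jetBracket (φ : BundleMap (jetSec V F E) (derSec V F E)) (μ ν : jetSec V F E) : jetSec V F E :=
  lieDeriv (φ.onSec μ) ν - lieDeriv (φ.onSec ν) μ + dJet (pairSec μ (φ.onSec ν))

/-! ### Skew-symmetry of `π^♯` and its compatibility with the brackets -/

namespace LieAlgebroid

variable (A : LieAlgebroid V F E)

/-- Both jets lift to global sections `u`, `v`, and the two pairings are then `[v, u](x)` and `[u,
v](x)`. -/
lemma pairing_piSharp_skew {x : M} (j k : Jet V F E x) :
    pairing x j (A.piSharp.toFun x k) = -pairing x k (A.piSharp.toFun x j) := by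
  obtain ⟨u, rfl⟩ := (jetZero V F E x).mkQ_surjective j
  obtain ⟨v, rfl⟩ := (jetZero V F E x).mkQ_surjective k
  change A.bracket v u x = -A.bracket u v x
  rw [A.skew]
  rfl

lemma pairSec_piSharp_skew (μ ν : jetSec V F E) :
    pairSec μ (A.piSharp.onSec ν) = -pairSec ν (A.piSharp.onSec μ) := by
  ext x
  exact A.pairing_piSharp_skew (μ.1 x) (ν.1 x)

/-- This turns an action into a pairing in which μ stands on the jet side, where `pairSec_lieDeriv`
applies. -/
lemma act_piSharp (μ : jetSec V F E) (u : Sec V F E) :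
    act (A.piSharp.onSec μ) u = -pairSec μ (A.piSharp.onSec (dJet u)) := by
  rw [← pairSec_dJet, A.pairSec_piSharp_skew]

variable {A} {φ : BundleIso (jetSec V F E) (derSec V F E)}

/-- If `π^♯` is an isomorphism, then elements of `𝔇E` are determined by their action. -/
lemma der_ext_of_iso (hφ : φ.toMap = A.piSharp) {x : M} {δ ε : Der V F E x}
    (h : ∀ u, δ.app u = ε.app u) : δ = ε := by
  have hp (k : Jet V F E x) : pairing x k δ = pairing x k ε := by
    obtain ⟨u, rfl⟩ := (jetZero V F E x).mkQ_surjective k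
    exact h u
  have hr (η : Der V F E x) : A.piSharp.toFun x (φ.inv.toFun x η) = η := by
    rw [← hφ, φ.right_inv]
  -- The pairing is nondegenerate in its jet argument. Testing against `η = π(π⁻¹η)`, skew-symmetry
  -- turns `⟨π⁻¹δ, η⟩` into `-⟨π⁻¹η, δ⟩`, which depends only on the action of δ.
  have hi : φ.inv.toFun x δ = φ.inv.toFun x ε := by
    refine jet_ext fun η => ?_
    rw [← hr η, A.pairing_piSharp_skew, A.pairing_piSharp_skew (φ.inv.toFun x ε), hr, hr, hp]
  rw [← hr δ, hi, hr]

lemma derSec_ext_of_iso (hφ : φ.toMap = A.piSharp) {d t : derSec V F E}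
    (h : ∀ u, act d u = act t u) : d = t :=
  Subtype.ext (funext fun x => der_ext_of_iso hφ fun u => DFunLike.congr_fun (h u) x)

/-- On actions this is the Jacobi identity. Equality of symbols, that is `a([u, v]) = [a(u), a(v)]`,
comes for free from `derSec_ext_of_iso`. -/
lemma derBracket_piSharp_dJet (hφ : φ.toMap = A.piSharp) (u v : Sec V F E) :
    derBracket (A.piSharp.onSec (dJet u)) (A.piSharp.onSec (dJet v)) =
      A.piSharp.onSec (dJet (A.bracket u v)) := by
  refine derSec_ext_of_iso hφ fun w => ?_
  change A.bracket u (A.bracket v w) - A.bracket v (A.bracket u w) = A.bracket (A.bracket u v) w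
  rw [A.jacobi u v w, add_sub_cancel_right]

/-- Evaluated on `v`, both sides equal `-(π𝕕w)⟨μ, π𝕕v⟩ + ⟨μ, π𝕕[w, v]⟩`; the case of two
prolongations identifies `[π𝕕w, π𝕕v]` with `π𝕕[w, v]`. -/
lemma derBracket_dJet_piSharp (hφ : φ.toMap = A.piSharp) (w : Sec V F E) (μ : jetSec V F E) :
    derBracket (A.piSharp.onSec (dJet w)) (A.piSharp.onSec μ) =
      A.piSharp.onSec (lieDeriv (A.piSharp.onSec (dJet w)) μ) := by
  refine derSec_ext_of_iso hφ fun v => ?_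
  rw [A.act_piSharp (lieDeriv _ _), pairSec_lieDeriv, derBracket_piSharp_dJet hφ, act_derBracket,
    A.act_piSharp μ v, map_neg, A.act_piSharp μ]
  -- By definition `π𝕕w` acts on `v` as `[w, v]`.
  change _ - -pairSec μ (A.piSharp.onSec (dJet (A.bracket w v))) = _
  abel

/-- If `π^♯` is an isomorphism, then it intertwines the brackets on sections of `𝔍E` and `𝔇E`. -/
lemma derBracket_piSharp (hφ : φ.toMap = A.piSharp) (μ ν : jetSec V F E) :
    derBracket (A.piSharp.onSec μ) (A.piSharp.onSec ν) =
      A.piSharp.onSec (jetBracket A.piSharp μ ν) := by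
  refine derSec_ext_of_iso hφ fun w => ?_
  -- By the previous stage `[πμ, π𝕕w] = -π(𝔏_{π𝕕w} μ)`, and skew-symmetry then exchanges ν with the
  -- Lie derivative.
  have key (μ ν : jetSec V F E) :
      pairSec ν (derBracket (A.piSharp.onSec μ) (A.piSharp.onSec (dJet w))) =
        pairSec (lieDeriv (A.piSharp.onSec (dJet w)) μ) (A.piSharp.onSec ν) := by
    rw [derBracket_skew, derBracket_dJet_piSharp hφ, A.pairSec_piSharp_skew _ ν,
      ← pairSec_neg_right]
  -- Evaluated on `w`, the claim reduces to `⟨ν, [πμ, π𝕕w]⟩ - ⟨μ, [πν, π𝕕w]⟩ = (π𝕕w)⟨μ, πν⟩`.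
  -- Applying `key` to the first term and expanding the Lie derivative yields the right side plus a
  -- term that cancels the second.
  rw [A.act_piSharp, jetBracket, pairSec_add, pairSec_sub, pairSec_lieDeriv, pairSec_lieDeriv,
    pairSec_dJet, key, pairSec_lieDeriv, act_derBracket, A.act_piSharp ν, A.act_piSharp μ w,
    map_neg, map_neg, derBracket_skew (A.piSharp.onSec (dJet w)), pairSec_neg_right]
  abel

end LieAlgebroid

end OmniLie

end

/-! ### The generalized complex structure -/

theorem mainTheorem9 {V : Type*} [NormedAddCommGroup V] [NormedSpace ℝ V] [FiniteDimensional ℝ V]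
    {M : Type*} [TopologicalSpace M] [T2Space M] [SecondCountableTopology M] [ChartedSpace V M]
    [IsManifold 𝓘(ℝ, V) ∞ M]
    {F : Type*} [NormedAddCommGroup F] [NormedSpace ℝ F] [FiniteDimensional ℝ F]
    {E : M → Type*} [TopologicalSpace (TotalSpace F E)]
    [∀ x, AddCommGroup (E x)] [∀ x, Module ℝ (E x)] [∀ x, TopologicalSpace (E x)]
    [FiberBundle F E] [VectorBundle ℝ F E] [ContMDiffVectorBundle ∞ F E 𝓘(ℝ, V)]
    (A : OmniLie.LieAlgebroid V F E)
    (φ : OmniLie.BundleIso (OmniLie.jetSec V F E) (OmniLie.derSec V F E))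
    (hφ : φ.toMap = A.piSharp) :
    OmniLie.IsGeneralizedComplex (OmniLie.offDiagonal φ) := by
  have pi_inv (d : OmniLie.derSec V F E) : A.piSharp.onSec (φ.inv.onSec d) = d :=
    Subtype.ext (funext fun x => by
      change A.piSharp.toFun x (φ.inv.toFun x (d.1 x)) = d.1 x
      rw [← hφ, φ.right_inv])
  have inv_pi (μ : OmniLie.jetSec V F E) : φ.inv.onSec (A.piSharp.onSec μ) = μ :=
    Subtype.ext (funext fun x => by
      change φ.inv.toFun x (A.piSharp.toFun x (μ.1 x)) = μ.1 x
      rw [← hφ, φ.left_inv])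
  refine ⟨fun x e => ?_, fun x e e' => ?_, fun s t => ?_⟩
  · change (φ.toMap.toFun x (-φ.inv.toFun x e.1), -φ.inv.toFun x (φ.toMap.toFun x e.2)) = -e
    rw [map_neg, φ.right_inv, φ.left_inv]
    rfl
  · change (1 / 2 : ℝ) • (OmniLie.pairing x (-φ.inv.toFun x e.1) (φ.toMap.toFun x e'.2)
      + OmniLie.pairing x (-φ.inv.toFun x e'.1) (φ.toMap.toFun x e.2)) =
      (1 / 2 : ℝ) • (OmniLie.pairing x e.2 e'.1 + OmniLie.pairing x e'.2 e.1)
    -- Skew-symmetry moves π onto `π⁻¹δ`, where the two cancel; the sign is absorbed by the one in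
    -- the lower block.
    have h (j : OmniLie.Jet V F E x) (δ : OmniLie.Der V F E x) :
        OmniLie.pairing x (-φ.inv.toFun x δ) (φ.toMap.toFun x j) = OmniLie.pairing x j δ := by
      rw [hφ, A.pairing_piSharp_skew, map_neg, map_neg, neg_neg, ← hφ, φ.right_inv]
    rw [h, h, add_comm]
  -- Writing the `𝔇E`-components as πα and πβ makes every bracket in `𝔇E` a bracket of images of π.
  · obtain ⟨α, hα⟩ : ∃ α, A.piSharp.onSec α = OmniLie.omniFst s := ⟨_, pi_inv _⟩
    obtain ⟨β, hβ⟩ : ∃ β, A.piSharp.onSec β = OmniLie.omniFst t := ⟨_, pi_inv _⟩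
    obtain ⟨μ, hμ⟩ : ∃ μ, μ = OmniLie.omniSnd s := ⟨_, rfl⟩
    obtain ⟨ν, hν⟩ : ∃ ν, ν = OmniLie.omniSnd t := ⟨_, rfl⟩
    have hs : s = OmniLie.omniMk (A.piSharp.onSec α) μ := by rw [hα, hμ]; rfl
    have ht : t = OmniLie.omniMk (A.piSharp.onSec β) ν := by rw [hβ, hν]; rfl
    have hJ (d : OmniLie.derSec V F E) (μ : OmniLie.jetSec V F E) :
        (OmniLie.offDiagonal φ).onSec (OmniLie.omniMk d μ) =
          OmniLie.omniMk (A.piSharp.onSec μ) (-φ.inv.onSec d) := by rw [← hφ]; rfl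
    have hD (d r : OmniLie.derSec V F E) (μ ν : OmniLie.jetSec V F E) :
        OmniLie.dorfman (OmniLie.omniMk d μ) (OmniLie.omniMk r ν) =
          OmniLie.omniMk (OmniLie.derBracket d r) (OmniLie.lieDeriv d ν - OmniLie.lieDeriv r μ
            + OmniLie.dJet (OmniLie.pairSec μ r)) := rfl
    have hadd (d r : OmniLie.derSec V F E) (μ ν : OmniLie.jetSec V F E) :
        OmniLie.omniMk d μ + OmniLie.omniMk r ν = OmniLie.omniMk (d + r) (μ + ν) := rfl
    have hsub (d r : OmniLie.derSec V F E) (μ ν : OmniLie.jetSec V F E) :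
        OmniLie.omniMk d μ - OmniLie.omniMk r ν = OmniLie.omniMk (d - r) (μ - ν) := rfl
    have padd (μ ν : OmniLie.jetSec V F E) :
        A.piSharp.onSec (μ + ν) = A.piSharp.onSec μ + A.piSharp.onSec ν :=
      Subtype.ext (funext fun x => map_add (A.piSharp.toFun x) (μ.1 x) (ν.1 x))
    have psub (μ ν : OmniLie.jetSec V F E) :
        A.piSharp.onSec (μ - ν) = A.piSharp.onSec μ - A.piSharp.onSec ν :=
      Subtype.ext (funext fun x => map_sub (A.piSharp.toFun x) (μ.1 x) (ν.1 x))
    rw [hs, ht]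
    -- Sums and differences are gathered inside a single π so that the outer `π⁻¹` cancels through
    -- `inv_pi`.
    simp only [hJ, hD, hadd, hsub, inv_pi, OmniLie.lieDeriv_neg, OmniLie.pairSec_neg,
      OmniLie.dJet_neg, A.derBracket_piSharp hφ, ← padd, ← psub]
    have e1 : OmniLie.omniMk (0 : OmniLie.derSec V F E) (0 : OmniLie.jetSec V F E) = 0 := rfl
    have e2 : A.piSharp.onSec (0 : OmniLie.jetSec V F E) = 0 :=
      Subtype.ext (funext fun x => map_zero (A.piSharp.toFun x))
    -- With zero written as `π0 + 0`, both components become identities between sections of `𝔍E`. In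
    -- the first, the `𝔍E`-parts of `⟦Js, t⟧ + ⟦s, Jt⟧` add up to `{μ, ν} - {α, β}`; in the second,
    -- `⟦Js, Jt⟧ - ⟦s, t⟧` contributes `-{μ, β} - {α, ν}`.
    rw [← e1, ← e2]
    congr 1
    · congr 1
      simp only [OmniLie.jetBracket]
      abel
    · simp only [OmniLie.jetBracket]
      abel
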